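/- Let $n$ be a positive integer and let $J\subseteq \mathbb{Z}_{2n+1}\setminus\{0\}$ satisfy $|J|=n$ and $|\{j,-j\}\cap J|=1$ for every $j\in J$. Let $\overrightarrow{C}_{2n+1}(J)$ be the circulant tournament with vertex set $\mathbb{Z}_{2n+1}$ and arc set $\{(i,j) : j-i\in J\}$. For a finite digraph $D$, let $\overrightarrow{\omega}(D)$ (the acyclic disconnection), respectively $\overrightarrow{\omega}_3(D)$ (the $\overrightarrow{C}_3$-free disconnection), be the maximum number of connected components of the underlying graph of $D\setminus A(D^*)$, where $D^*$ ranges over the subdigraphs of $D$ that contain no directed cycle, respectively no directed cycle of length three. Then $$\overrightarrow{\omega}\bigl(\overrightarrow{C}_{2n+1}(J)\bigr)=\overrightarrow{\omega}_3\bigl(\overrightarrow{C}_{2n+1}(J)\bigr).$$ -/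

import Mathlib

/-- `D` contains a directed cycle of length `k`: distinct vertices, indexed cyclically by `ZMod k`,
with an arc from each one to the next. (Used only for `k ≥ 1`.) -/
def Digraph.HasDirectedCycle {V : Type*} (D : Digraph V) (k : ℕ) : Prop :=
  ∃ c : ZMod k → V, Function.Injective c ∧ ∀ i, D.Adj (c i) (c (i + 1))

/-- A digraph is acyclic if it contains no directed cycle. -/
def Digraph.IsDirectedAcyclic {V : Type*} (D : Digraph V) : Prop :=
  ∀ k : ℕ, 1 ≤ k → ¬ D.HasDirectedCycle k

/-- A digraph is directed-triangle-free if it contains no directed cycle of length three. -/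
def Digraph.IsDirectedTriangleFree {V : Type*} (D : Digraph V) : Prop :=
  ¬ D.HasDirectedCycle 3

/-- The number of connected components of the underlying (undirected) graph of `D`. -/
noncomputable def Digraph.numComponents {V : Type*} (D : Digraph V) : ℕ :=
  Nat.card D.toSimpleGraphInclusive.ConnectedComponent

/-- The acyclic disconnection of a finite digraph `D`: the maximum number of connected components
of the underlying graph of `D` minus the arcs of `H`, over the acyclic subdigraphs `H` of `D`.
(Only the arcs of `H` matter, so `H` may be taken to have all vertices of `D`.) -/
noncomputable def Digraph.acyclicDisconnection {V : Type*} [Finite V] (D : Digraph V) : ℕ :=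
  sSup {k : ℕ | ∃ H : Digraph V, H ≤ D ∧ H.IsDirectedAcyclic ∧ (D \ H).numComponents = k}

/-- The `C₃`-free disconnection of a finite digraph `D`: the maximum number of connected components
of the underlying graph of `D` minus the arcs of `H`, over the directed-triangle-free
subdigraphs `H` of `D`. -/
noncomputable def Digraph.triangleFreeDisconnection {V : Type*} [Finite V] (D : Digraph V) : ℕ :=
  sSup {k : ℕ | ∃ H : Digraph V, H ≤ D ∧ H.IsDirectedTriangleFree ∧ (D \ H).numComponents = k}

theorem Digraph.numComponents_le {V : Type*} [Finite V] (D : Digraph V) :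
    D.numComponents ≤ Nat.card V :=
  Nat.card_le_card_of_surjective D.toSimpleGraphInclusive.connectedComponentMk Quot.mk_surjective

theorem Digraph.bot_isDirectedAcyclic {V : Type*} : (⊥ : Digraph V).IsDirectedAcyclic := by
  rintro k - ⟨c, -, h⟩
  exact h 0

/-- The supremum defining the acyclic disconnection is an attained maximum. -/
theorem Digraph.isGreatest_acyclicDisconnection {V : Type*} [Finite V] (D : Digraph V) :
    IsGreatest {k : ℕ | ∃ H : Digraph V, H ≤ D ∧ H.IsDirectedAcyclic ∧ (D \ H).numComponents = k}
      D.acyclicDisconnection := by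
  have hb : BddAbove {k : ℕ | ∃ H : Digraph V, H ≤ D ∧ H.IsDirectedAcyclic ∧
      (D \ H).numComponents = k} := by
    refine ⟨Nat.card V, ?_⟩
    rintro k ⟨H, -, -, rfl⟩
    exact Digraph.numComponents_le _
  exact ⟨Nat.sSup_mem ⟨_, ⊥, bot_le, Digraph.bot_isDirectedAcyclic, rfl⟩ hb,
    fun k hk => le_csSup hb hk⟩

/-- The supremum defining the `C₃`-free disconnection is an attained maximum. -/
theorem Digraph.isGreatest_triangleFreeDisconnection {V : Type*} [Finite V] (D : Digraph V) :
    IsGreatest {k : ℕ | ∃ H : Digraph V, H ≤ D ∧ H.IsDirectedTriangleFree ∧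
      (D \ H).numComponents = k} D.triangleFreeDisconnection := by
  have hb : BddAbove {k : ℕ | ∃ H : Digraph V, H ≤ D ∧ H.IsDirectedTriangleFree ∧
      (D \ H).numComponents = k} := by
    refine ⟨Nat.card V, ?_⟩
    rintro k ⟨H, -, -, rfl⟩
    exact Digraph.numComponents_le _
  exact ⟨Nat.sSup_mem ⟨_, ⊥, bot_le, Digraph.bot_isDirectedAcyclic 3 (by norm_num), rfl⟩ hb,
    fun k hk => le_csSup hb hk⟩

/-- `J` is the symbol set of a circulant tournament of order `2n+1`: `J ⊆ ℤ_{2n+1} \ {0}`,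
`|J| = n`, and `|{j, -j} ∩ J| = 1` for every `j ∈ J`. -/
structure IsTournamentSymbolSet (n : ℕ) (J : Finset (ZMod (2 * n + 1))) : Prop where
  zero_notMem : (0 : ZMod (2 * n + 1)) ∉ J
  card_eq : J.card = n
  card_pair_inter : ∀ j ∈ J, (({j, -j} : Finset (ZMod (2 * n + 1))) ∩ J).card = 1

/-- The circulant digraph on `ℤ_{2n+1}` with arcs `(i, j)` for `j - i ∈ J`; it is the circulant
tournament `C_{2n+1}(J)` when `J` is a symbol set. -/
def circulantTournament (n : ℕ) (J : Finset (ZMod (2 * n + 1))) : Digraph (ZMod (2 * n + 1)) where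
  Adj i j := j - i ∈ J

/-! Deleting a subdigraph and counting components amounts to colouring vertices: triangle-free
subdigraphs correspond to colourings without rainbow directed triangles, acyclic ones to colourings
whose bichromatic arcs increase a height. It suffices to turn any colouring of the first kind into
one of the second kind with at least as many colours
(`RainbowTriangleFree.exists_acyclicColouring`). This is done for Cayley tournaments on all finite
abelian groups, by induction on the order.

If no proper nontrivial subgroup is a module, at most two colours occur
(`RainbowTriangleFree.not_three_colours`), and isolating the vertex 0 gives two colours acyclically.
Otherwise let `H` be a maximal proper module. The quotient is simple, so three distinct cosets never
show three colours, and some coset of `H` misses at most one colour. Induction applies to that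
coset, and the complement of `H` supplies one extra colour.

The simple case rests on an isoperimetric inequality: if `U` dominates `M`, both nonempty, then
`2(|U| + |M|) ≤ |G| + 1` (`Dominates.card_le`). Applied along a chain of predecessor-closed sets, it
forces a three-colouring to have a one-vertex class. A connectivity argument on directed triangles
then shows that the remaining vertices share one colour. -/

/-- `J` is the connection set of a Cayley tournament on the abelian group `G`: exactly one of
`x` and `-x` lies in `J` for every `x ≠ 0`. -/
structure IsTournamentSet {G : Type*} [AddCommGroup G] (J : Set G) : Prop where
  zero_notMem : (0 : G) ∉ J
  neg_notMem : ∀ x ∈ J, -x ∉ J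
  total : ∀ x, x ≠ 0 → x ∈ J ∨ -x ∈ J

/-- The subgroup `H` is a homogeneous set (module) of the Cayley tournament of `J`. -/
def IsModuleSubgroup {G : Type*} [AddCommGroup G] (J : Set G) (H : AddSubgroup G) : Prop :=
  ∀ j ∈ J, j ∉ H → ∀ h ∈ H, j + h ∈ J

/-- The Cayley tournament of `J` has no module which is a proper nontrivial subgroup. -/
def IsSimpleTournamentSet {G : Type*} [AddCommGroup G] (J : Set G) : Prop :=
  ∀ H : AddSubgroup G, IsModuleSubgroup J H → H = ⊥ ∨ H = ⊤

/-! ### Isoperimetric inequality for dominating pairs. -/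

section Isoperimetry

variable {G : Type*} [AddCommGroup G] {J : Set G}

/-- Every vertex of `U` dominates every vertex of `M`. -/
def Dominates (J : Set G) (U M : Finset G) : Prop :=
  ∀ u ∈ U, ∀ m ∈ M, m - u ∈ J

-- The sets `H`, `M` and `-M` are disjoint, which suffices when `H` is trivial. Otherwise `H` fails
-- to be a module at some `j`, and the whole coset `j + H` avoids all three, so `|U|` is counted
-- twice.
open Classical in
theorem Dominates.card_le_of_subgroup [Fintype G] (hJ : IsTournamentSet J)
    (hs : IsSimpleTournamentSet J) (H : AddSubgroup G) {U M : Finset G}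
    (hU : ∀ x, x ∈ U ↔ x ∈ H) (hM : M.Nonempty) (hd : Dominates J U M) :
    2 * (U.card + M.card) ≤ Fintype.card G + 1 := by
  have hMJ : ∀ m ∈ M, m ∈ J := fun m hm => by
    simpa using hd 0 ((hU 0).2 H.zero_mem) m hm
  have hMH : ∀ m ∈ M, m ∉ H := fun m hm hmH => by
    have := hd m ((hU m).2 hmH) m hm
    rw [sub_self] at this
    exact hJ.zero_notMem this
  have hcardneg : (M.image (fun x => -x)).card = M.card :=
    Finset.card_image_of_injective _ neg_injective
  have d1 : Disjoint M (M.image (fun x => -x)) := by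
    rw [Finset.disjoint_left]
    intro a ha ha'
    obtain ⟨b, hb, rfl⟩ := Finset.mem_image.1 ha'
    exact hJ.neg_notMem b (hMJ b hb) (hMJ _ ha)
  have d2 : Disjoint U (M ∪ M.image (fun x => -x)) := by
    rw [Finset.disjoint_left]
    intro a ha ha'
    rcases Finset.mem_union.1 ha' with h | h
    · exact hMH a h ((hU a).1 ha)
    · obtain ⟨b, hb, rfl⟩ := Finset.mem_image.1 h
      exact hMH b hb (by simpa using H.neg_mem ((hU _).1 ha))
  by_cases hbot : H = ⊥
  · have hU1 : U.card = 1 := by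
      rw [Finset.card_eq_one]
      exact ⟨0, by ext x; rw [hU, hbot]; simp⟩
    have := Finset.card_le_univ (U ∪ (M ∪ M.image (fun x => -x)))
    rw [Finset.card_union_of_disjoint d2, Finset.card_union_of_disjoint d1, hcardneg] at this
    omega
  · have hmod : ¬ IsModuleSubgroup J H := by
      intro hm
      rcases hs H hm with h | h
      · exact hbot h
      · obtain ⟨m, hm⟩ := hM
        exact hMH m hm (h ▸ AddSubgroup.mem_top m)
    unfold IsModuleSubgroup at hmod
    push Not at hmod
    obtain ⟨j, hj, hjH, h, hh, hjh⟩ := hmod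
    have hcardj : (U.image (fun x => j + x)).card = U.card :=
      Finset.card_image_of_injective _ (add_right_injective j)
    -- If `j + b` were in `M`, domination by `b - h` would give `j + h ∈ J`; if it were in `-M`,
    -- domination by `-b` would give `-j ∈ J`.
    have d3 : Disjoint (U.image (fun x => j + x)) (U ∪ (M ∪ M.image (fun x => -x))) := by
      rw [Finset.disjoint_left]
      intro a ha ha'
      obtain ⟨b, hb, rfl⟩ := Finset.mem_image.1 ha
      have hbH := (hU b).1 hb
      rcases Finset.mem_union.1 ha' with h' | h'
      · exact hjH ((H.add_mem_cancel_right hbH).1 ((hU _).1 h'))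
      rcases Finset.mem_union.1 h' with h' | h'
      · have := hd (b - h) ((hU _).2 (H.sub_mem hbH hh)) _ h'
        exact hjh (by convert this using 1; abel)
      · obtain ⟨m, hm, hmb⟩ := Finset.mem_image.1 h'
        have := hd (-b) ((hU _).2 (H.neg_mem hbH)) _ hm
        have e : m - -b = -j := by
          have : m = -(j + b) := by rw [← hmb]; simp
          rw [this]; abel
        rw [e] at this
        exact hJ.neg_notMem j hj this
    have := Finset.card_le_univ
      (U.image (fun x => j + x) ∪ (U ∪ (M ∪ M.image (fun x => -x))))
    rw [Finset.card_union_of_disjoint d3, Finset.card_union_of_disjoint d2,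
      Finset.card_union_of_disjoint d1, hcardneg, hcardj] at this
    omega

open Classical in
/-- In a simple Cayley tournament on `2 * n + 1` vertices, if `U` dominates `M` then
`|U| + |M| ≤ n + 1`. -/
theorem Dominates.card_le [Fintype G] (hJ : IsTournamentSet J)
    (hs : IsSimpleTournamentSet J) {U M : Finset G} (hU : U.Nonempty) (hM : M.Nonempty)
    (hd : Dominates J U M) : 2 * (U.card + M.card) ≤ Fintype.card G + 1 := by
  let 𝓟 : Finset (Finset G × Finset G) := Finset.univ.filter
    fun p => p.1.Nonempty ∧ p.2.Nonempty ∧ Dominates J p.1 p.2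
  have h𝓟 : ∀ p, p ∈ 𝓟 ↔ p.1.Nonempty ∧ p.2.Nonempty ∧ Dominates J p.1 p.2 := fun p => by
    simp [𝓟]
  -- Extremal choice: `|A| + |B|` is maximal and, subject to that, `|A|` is minimal.
  obtain ⟨p₀, hp₀, hmax₀⟩ := Finset.exists_max_image 𝓟 (fun p => p.1.card + p.2.card)
    ⟨(U, M), (h𝓟 _).2 ⟨hU, hM, hd⟩⟩
  let 𝓠 := 𝓟.filter fun p => p₀.1.card + p₀.2.card ≤ p.1.card + p.2.card
  obtain ⟨⟨A, B⟩, hAB, hmin⟩ := Finset.exists_min_image 𝓠 (fun p => p.1.card)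
    ⟨p₀, Finset.mem_filter.2 ⟨hp₀, le_rfl⟩⟩
  obtain ⟨hAB', hw⟩ := Finset.mem_filter.1 hAB
  obtain ⟨hA, hB, hdAB⟩ : A.Nonempty ∧ B.Nonempty ∧ Dominates J A B := (h𝓟 _).1 hAB'
  have hmax : ∀ X Y : Finset G, X.Nonempty → Y.Nonempty → Dominates J X Y →
      X.card + Y.card ≤ A.card + B.card := fun X Y hX hY h =>
    (hmax₀ (X, Y) ((h𝓟 _).2 ⟨hX, hY, h⟩)).trans hw
  have hmin' : ∀ X Y : Finset G, X.Nonempty → Y.Nonempty → Dominates J X Y →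
      A.card + B.card ≤ X.card + Y.card → A.card ≤ X.card := fun X Y hX hY h hc =>
    hmin (X, Y) (Finset.mem_filter.2 ⟨(h𝓟 _).2 ⟨hX, hY, h⟩, hw.trans hc⟩)
  -- Negation reverses arcs, so `(-B, -A)` is a competing pair of the same total size.
  have hle : A.card ≤ B.card := by
    have hn : ∀ S : Finset G, (S.image (fun x => -x)).card = S.card := fun S =>
      Finset.card_image_of_injective _ neg_injective
    have := hmin' (B.image fun x => -x) (A.image fun x => -x) (hB.image _) (hA.image _)
      (by
        intro u hu m hm
        obtain ⟨b, hb, rfl⟩ := Finset.mem_image.1 hu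
        obtain ⟨a, ha, rfl⟩ := Finset.mem_image.1 hm
        have := hdAB a ha b hb
        rwa [neg_sub_neg]) (by rw [hn, hn, add_comm])
    rwa [hn] at this
  -- Uncrossing: `(A ∩ A', B ∪ B')` and `(A ∪ A', B ∩ B')` are dominating pairs whose sizes add up
  -- to twice the maximum, so both are optimal and minimality of `|A|` gives `A ∩ A' = A`. The bound
  -- `|A| ≤ |B|` ensures that `B ∩ B'` is nonempty. Hence `A` is a coset of a subgroup.
  have hblock : ∀ g : G, (A ∩ A.image (fun x => x + g)).Nonempty → A.image (fun x => x + g) = A := by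
    intro g hne
    set A' := A.image (fun x => x + g) with hA'
    set B' := B.image (fun x => x + g) with hB'
    have hcA : A'.card = A.card := Finset.card_image_of_injective _ (add_left_injective g)
    have hcB : B'.card = B.card := Finset.card_image_of_injective _ (add_left_injective g)
    have hd' : Dominates J A' B' := by
      intro u hu m hm
      obtain ⟨a, ha, rfl⟩ := Finset.mem_image.1 hu
      obtain ⟨b, hb, rfl⟩ := Finset.mem_image.1 hm
      rw [add_sub_add_right_eq_sub]
      exact hdAB a ha b hb
    have dI : Dominates J (A ∩ A') (B ∪ B') := by
      intro u hu m hm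
      rcases Finset.mem_union.1 hm with h | h
      · exact hdAB u (Finset.mem_inter.1 hu).1 m h
      · exact hd' u (Finset.mem_inter.1 hu).2 m h
    have dU : Dominates J (A ∪ A') (B ∩ B') := by
      intro u hu m hm
      rcases Finset.mem_union.1 hu with h | h
      · exact hdAB u h m (Finset.mem_inter.1 hm).1
      · exact hd' u h m (Finset.mem_inter.1 hm).2
    have c1 := Finset.card_union_add_card_inter A A'
    have c2 := Finset.card_union_add_card_inter B B'
    have m1 := hmax _ _ hne (hB.mono Finset.subset_union_left) dI
    have hpos := hne.card_pos
    have hBne : (B ∩ B').Nonempty := by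
      rw [← Finset.card_pos]
      omega
    have m2 := hmax _ _ (hA.mono Finset.subset_union_left) hBne dU
    have m3 := hmin' _ _ hne (hB.mono Finset.subset_union_left) dI (by omega)
    have e1 : A ∩ A' = A := Finset.eq_of_subset_of_card_le Finset.inter_subset_left m3
    have : A ⊆ A' := by rw [← e1]; exact Finset.inter_subset_right
    exact (Finset.eq_of_subset_of_card_le this hcA.le).symm
  obtain ⟨a, ha⟩ := hA
  have hadd : ∀ x y, x + a ∈ A → y + a ∈ A → x + y + a ∈ A := by
    intro x y hx hy
    have := hblock y ⟨y + a, Finset.mem_inter.2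
      ⟨hy, Finset.mem_image.2 ⟨a, ha, add_comm _ _⟩⟩⟩
    rw [← this]
    exact Finset.mem_image.2 ⟨x + a, hx, by abel⟩
  have hneg : ∀ x, x + a ∈ A → -x + a ∈ A := by
    intro x hx
    have := hblock x ⟨x + a, Finset.mem_inter.2
      ⟨hx, Finset.mem_image.2 ⟨a, ha, add_comm _ _⟩⟩⟩
    rw [← this] at ha
    obtain ⟨b, hb, hba⟩ := Finset.mem_image.1 ha
    have : -x + a = b := by rw [← hba]; abel
    rwa [this]
  let H : AddSubgroup G :=
    { carrier := {x | x + a ∈ A}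
      add_mem' := fun {x y} hx hy => hadd x y hx hy
      zero_mem' := by simpa using ha
      neg_mem' := fun {x} hx => hneg x hx }
  have key := Dominates.card_le_of_subgroup hJ hs H (U := A.image (fun x => x - a))
    (M := B.image (fun x => x - a)) (by
      intro x
      constructor
      · intro hx
        obtain ⟨y, hy, rfl⟩ := Finset.mem_image.1 hx
        change y - a + a ∈ A
        simpa using hy
      · intro hx
        exact Finset.mem_image.2 ⟨x + a, hx, by abel⟩) (hB.image _) (by
      intro u hu m hm
      obtain ⟨x, hx, rfl⟩ := Finset.mem_image.1 hu
      obtain ⟨y, hy, rfl⟩ := Finset.mem_image.1 hm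
      rw [sub_sub_sub_cancel_right]
      exact hdAB x hx y hy)
  rw [Finset.card_image_of_injective _ sub_left_injective,
    Finset.card_image_of_injective _ sub_left_injective] at key
  have := hmax U M hU hM hd
  omega

end Isoperimetry

/-! ### Three-colourings without rainbow triangles: a one-vertex class. -/

/-- The number of vertices of colour `i` in `D`. -/
def colourCount {V ι : Type*} [DecidableEq ι] (f : V → ι) (i : ι) (D : Finset V) : ℕ :=
  (D.filter fun v => f v = i).card

theorem colourCount_pos {V ι : Type*} [DecidableEq ι] {f : V → ι} {D : Finset V} {v : V} (h : v ∈ D) :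
    0 < colourCount f (f v) D :=
  Finset.card_pos.2 ⟨v, Finset.mem_filter.2 ⟨h, rfl⟩⟩

theorem colourCount_union {V ι : Type*} [DecidableEq ι] {f : V → ι} [DecidableEq V] {D S : Finset V} (h : Disjoint D S)
    (i : ι) : colourCount f i (D ∪ S) = colourCount f i D + colourCount f i S := by
  unfold colourCount
  rw [Finset.filter_union, Finset.card_union_of_disjoint (Finset.disjoint_filter_filter h)]

theorem colourCount_singleton {V ι : Type*} [DecidableEq ι] {f : V → ι} (i : ι) (s : V) :
    colourCount f i {s} = if f s = i then 1 else 0 := by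
  unfold colourCount
  rw [Finset.filter_singleton]
  split_ifs <;> simp

section Rainbow

variable {G : Type*} [AddCommGroup G] {ι : Type*} {J : Set G} {f : G → ι}

/-- No directed triangle of the Cayley digraph of `J` receives three colours. -/
def RainbowTriangleFree (J : Set G) (f : G → ι) : Prop :=
  ∀ u v w, v - u ∈ J → w - v ∈ J → u - w ∈ J → f u = f v ∨ f v = f w ∨ f w = f u

/-- An arc of the Cayley digraph of `J` whose ends have different colours. -/
def BichromaticArc (J : Set G) (f : G → ι) (u v : G) : Prop :=
  v - u ∈ J ∧ f u ≠ f v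

theorem IsTournamentSet.adj_or (hJ : IsTournamentSet J) {u v : G} (h : u ≠ v) :
    v - u ∈ J ∨ u - v ∈ J := by
  rcases hJ.total (v - u) (sub_ne_zero.2 h.symm) with h | h
  · exact Or.inl h
  · exact Or.inr (by simpa using h)

theorem IsTournamentSet.adj_asymm (hJ : IsTournamentSet J) {u v : G} (h : v - u ∈ J) :
    u - v ∉ J := by
  simpa using hJ.neg_notMem _ h

theorem BichromaticArc.of_not (hJ : IsTournamentSet J) {u v : G} (hc : f u ≠ f v)
    (h : ¬ BichromaticArc J f v u) : BichromaticArc J f u v := by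
  rcases hJ.adj_or (u := u) (v := v) (fun e => hc (congrArg f e)) with h' | h'
  · exact ⟨h', hc⟩
  · exact absurd ⟨h', hc.symm⟩ h

theorem BichromaticArc.asymm (hJ : IsTournamentSet J) {u v : G} (h : BichromaticArc J f u v) :
    ¬ BichromaticArc J f v u := fun h' => hJ.adj_asymm h.1 h'.1

theorem RainbowTriangleFree.trans (hJ : IsTournamentSet J) (hf : RainbowTriangleFree J f)
    {u v w : G} (h₁ : BichromaticArc J f u v) (h₂ : BichromaticArc J f v w) (hc : f u ≠ f w) :
    BichromaticArc J f u w := by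
  refine BichromaticArc.of_not hJ hc fun h₃ => ?_
  rcases hf u v w h₁.1 h₂.1 h₃.1 with h | h | h
  · exact h₁.2 h
  · exact h₂.2 h
  · exact h₃.2 h

/-- There is a walk with exactly `m` arcs, all of them bichromatic, from `u` to `v`. -/
def BichromaticWalk (J : Set G) (f : G → ι) : ℕ → G → G → Prop
  | 0, u, v => u = v
  | m + 1, u, v => ∃ w, BichromaticArc J f u w ∧ BichromaticWalk J f m w v

theorem BichromaticWalk.append {m k : ℕ} {u v w : G} (h₁ : BichromaticWalk J f m u v)
    (h₂ : BichromaticWalk J f k v w) : BichromaticWalk J f (m + k) u w := by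
  induction m generalizing u with
  | zero => obtain rfl : u = v := h₁; simpa using h₂
  | succ m ih =>
    obtain ⟨x, hx, hxv⟩ := h₁
    rw [Nat.succ_add]
    exact ⟨x, hx, ih hxv⟩

theorem BichromaticWalk.of_reflTransGen {u v : G}
    (h : Relation.ReflTransGen (BichromaticArc J f) u v) : ∃ m, BichromaticWalk J f m u v := by
  induction h using Relation.ReflTransGen.head_induction_on with
  | refl => exact ⟨0, rfl⟩
  | head hab _ ih =>
    obtain ⟨m, hm⟩ := ih
    exact ⟨m + 1, _, hab, hm⟩

/-- A walk starting with an arc `a → u` either avoids the colour `i` from `u` on, in which case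
every vertex of colour `i` dominated by the end is dominated by `u`, or it enters colour `i`. -/
theorem BichromaticWalk.avoids_or_enters (hJ : IsTournamentSet J)
    (hf : RainbowTriangleFree J f) {i : ι} {m : ℕ} {a u v : G} (hau : BichromaticArc J f a u)
    (ha : f a ≠ i) (hu : f u ≠ i) (h : BichromaticWalk J f m u v) :
    (f v ≠ i ∧ ∀ b, f b = i → BichromaticArc J f v b → BichromaticArc J f u b) ∨
    ∃ k l p q r, BichromaticWalk J f k a p ∧ BichromaticArc J f p q ∧ BichromaticArc J f q r ∧
      f p ≠ f r ∧ BichromaticWalk J f l r v ∧ k + l + 1 = m := by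
  induction m generalizing a u with
  | zero =>
    obtain rfl : u = v := h
    exact Or.inl ⟨hu, fun _ _ h => h⟩
  | succ m ih =>
    obtain ⟨w, huw, hwv⟩ := h
    by_cases hw : f w = i
    · exact Or.inr ⟨0, m, a, u, w, rfl, hau, huw, hw ▸ ha, hwv, by omega⟩
    · rcases ih huw hu hw hwv with h | ⟨k, l, p, q, r, h₁, h₂, h₃, h₄, h₅, h₆⟩
      · refine Or.inl ⟨h.1, fun b hb hvb => ?_⟩
        exact hf.trans hJ huw (h.2 b hb hvb) (hb ▸ hu)
      · exact Or.inr ⟨k + 1, l, p, q, r, ⟨u, hau, h₁⟩, h₂, h₃, h₄, h₅, by omega⟩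

/-- A closed walk of bichromatic arcs has no three consecutive vertices of distinct colours. -/
theorem RainbowTriangleFree.eq_of_walk (hJ : IsTournamentSet J)
    (hf : RainbowTriangleFree J f) {m : ℕ} {x y z : G} (hxy : BichromaticArc J f x y)
    (hyz : BichromaticArc J f y z) (h : BichromaticWalk J f m z x) : f x = f z := by
  induction m using Nat.strong_induction_on generalizing x y z with
  | _ m ih =>
    by_contra hc
    -- With `x → z` as a shortcut, a return walk entering the colour of `y` yields a shorter closed
    -- walk with three consecutive colours. A walk avoiding that colour transports `x → y` back to
    -- `z → y`, contradicting `y → z`.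
    have hxz := hf.trans hJ hxy hyz hc
    rcases h.avoids_or_enters hJ hf hxz hxy.2 hyz.2.symm with h' | ⟨k, l, p, q, r, h₁, h₂, h₃, h₄, h₅, h₆⟩
    · exact hyz.asymm hJ (h'.2 y rfl hxy)
    · exact h₄ (ih (l + k) (by omega) h₂ h₃ (h₅.append h₁))

theorem RainbowTriangleFree.eq_of_reflTransGen (hJ : IsTournamentSet J)
    (hf : RainbowTriangleFree J f) {x y z : G} (hxy : BichromaticArc J f x y)
    (hyz : BichromaticArc J f y z) (h : Relation.ReflTransGen (BichromaticArc J f) z x) :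
    f x = f z := by
  obtain ⟨m, hm⟩ := BichromaticWalk.of_reflTransGen h
  exact hf.eq_of_walk hJ hxy hyz hm

/-- In a nontrivial strong component of bichromatic arcs only two colours occur. -/
theorem RainbowTriangleFree.two_colours (hJ : IsTournamentSet J)
    (hf : RainbowTriangleFree J f) {p x w : G} (hpx : BichromaticArc J f p x)
    (hxp : Relation.ReflTransGen (BichromaticArc J f) x p)
    (hxw : Relation.ReflTransGen (BichromaticArc J f) x w)
    (hwx : Relation.ReflTransGen (BichromaticArc J f) w x) : f w = f x ∨ f w = f p := by
  -- Colours alternate along the walk, so the invariant records the colours of the current vertex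
  -- and of a predecessor.
  have key : ∃ q, BichromaticArc J f q w ∧ Relation.ReflTransGen (BichromaticArc J f) x q ∧
      ((f q = f p ∧ f w = f x) ∨ (f q = f x ∧ f w = f p)) := by
    induction hxw with
    | refl => exact ⟨p, hpx, hxp, Or.inl ⟨rfl, rfl⟩⟩
    | @tail v w hxv hvw ih =>
      obtain ⟨q, hqv, hxq, hcol⟩ := ih (Relation.ReflTransGen.head hvw hwx)
      have := hf.eq_of_reflTransGen hJ hqv hvw (hwx.trans hxq)
      refine ⟨v, hvw, hxv, ?_⟩
      rcases hcol with h | h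
      · exact Or.inr ⟨h.2, this ▸ h.1⟩
      · exact Or.inl ⟨h.2, this ▸ h.1⟩
  obtain ⟨q, -, -, h | h⟩ := key
  · exact Or.inl h.2
  · exact Or.inr h.2

/-- `D` contains every in-neighbour of its vertices along bichromatic arcs. -/
def IsPredClosed (J : Set G) (f : G → ι) (D : Finset G) : Prop :=
  ∀ u v, BichromaticArc J f u v → v ∈ D → u ∈ D

theorem IsPredClosed.of_reflTransGen {D : Finset G} (hD : IsPredClosed J f D) {u v : G}
    (h : Relation.ReflTransGen (BichromaticArc J f) u v) (hv : v ∈ D) : u ∈ D := by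
  induction h using Relation.ReflTransGen.head_induction_on with
  | refl => exact hv
  | head hab _ ih => exact hD _ _ hab ih

open Classical in
/-- A proper predecessor-closed set can be enlarged by one strong component, which is either a
single vertex, or misses one of the three colours and has no colour appearing only once. -/
theorem IsPredClosed.exists_step [Fintype G] (hJ : IsTournamentSet J) {f : G → Fin 3}
    (hf : RainbowTriangleFree J f) {D : Finset G} (hD : IsPredClosed J f D)
    (hne : ∃ v, v ∉ D) :
    ∃ S : Finset G, Disjoint D S ∧ IsPredClosed J f (D ∪ S) ∧
      ((∃ s, S = {s}) ∨ (S.Nonempty ∧ (∃ i, ∀ s ∈ S, f s ≠ i) ∧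
        ∀ s ∈ S, ∃ t ∈ S, t ≠ s ∧ f t = f s)) := by
  let R := Relation.ReflTransGen (BichromaticArc J f)
  let anc : G → Finset G := fun u => Finset.univ.filter fun w => R w u
  -- With fewest ancestors among vertices outside `D`, `u` lies in a source component of the
  -- complement.
  obtain ⟨u, hu, hmin⟩ := Finset.exists_min_image (Finset.univ.filter fun v => v ∉ D)
    (fun v => (anc v).card) (by obtain ⟨v, hv⟩ := hne; exact ⟨v, by simpa using hv⟩)
  replace hu : u ∉ D := by simpa using hu
  have hback : ∀ w, R w u → w ∉ D → R u w := by
    intro w hwu hw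
    have hsub : anc w ⊆ anc u := by
      intro x hx
      have : R x w := by simpa [anc] using hx
      simpa [anc] using this.trans hwu
    have := Finset.eq_of_subset_of_card_le hsub (hmin w (by simpa using hw))
    have hu' : u ∈ anc u := by simpa [anc] using Relation.ReflTransGen.refl
    rw [← this] at hu'
    simpa [anc] using hu'
  let S : Finset G := Finset.univ.filter fun w => R w u ∧ R u w
  have hS : ∀ w, w ∈ S ↔ R w u ∧ R u w := fun w => by simp [S]
  have huS : u ∈ S := (hS u).2 ⟨.refl, .refl⟩
  refine ⟨S, ?_, ?_, ?_⟩
  · rw [Finset.disjoint_left]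
    intro w hw hwS
    exact hu (hD.of_reflTransGen ((hS w).1 hwS).2 hw)
  · intro v w hvw hw
    rcases Finset.mem_union.1 hw with hw | hw
    · exact Finset.mem_union_left _ (hD _ _ hvw hw)
    · have hvu : R v u := Relation.ReflTransGen.head hvw ((hS w).1 hw).1
      by_cases hv : v ∈ D
      · exact Finset.mem_union_left _ hv
      · exact Finset.mem_union_right _ ((hS v).2 ⟨hvu, hback v hvu hv⟩)
  · by_cases hsing : ∀ w ∈ S, w = u
    · exact Or.inl ⟨u, Finset.eq_singleton_iff_unique_mem.2 ⟨huS, hsing⟩⟩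
    · right
      push Not at hsing
      obtain ⟨t, htS, htu⟩ := hsing
      have hsucc : ∀ s ∈ S, ∃ y ∈ S, BichromaticArc J f s y := by
        intro s hs
        obtain ⟨t', ht', hts⟩ : ∃ t' ∈ S, t' ≠ s := by
          by_cases h : s = u
          · exact ⟨t, htS, h ▸ htu⟩
          · exact ⟨u, huS, fun e => h e.symm⟩
        have hst : R s t' := ((hS s).1 hs).1.trans ((hS t').1 ht').2
        rcases Relation.ReflTransGen.cases_head hst with h | ⟨y, hsy, hyt⟩
        · exact absurd h.symm hts
        · exact ⟨y, (hS y).2 ⟨hyt.trans ((hS t').1 ht').1,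
            ((hS s).1 hs).2.trans (Relation.ReflTransGen.single hsy)⟩, hsy⟩
      refine ⟨⟨u, huS⟩, ?_, ?_⟩
      · obtain ⟨y, hyS, huy⟩ := hsucc u huS
        obtain ⟨i, hi⟩ : ∃ i : Fin 3, i ≠ f u ∧ i ≠ f y := by
          generalize f u = a
          generalize f y = b
          revert a b
          decide
        refine ⟨i, fun s hs hsi => ?_⟩
        have hyu := ((hS y).1 hyS).1
        have huy' := ((hS y).1 hyS).2
        rcases hf.two_colours hJ huy hyu (hyu.trans ((hS s).1 hs).2)
          (((hS s).1 hs).1.trans huy') with h | h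
        · exact hi.2 (hsi ▸ h)
        · exact hi.1 (hsi ▸ h)
      · intro s hs
        obtain ⟨y, hyS, hsy⟩ := hsucc s hs
        obtain ⟨z, hzS, hyz⟩ := hsucc y hyS
        refine ⟨z, hzS, fun e => ?_, ?_⟩
        · rw [e] at hyz
          exact hsy.asymm hJ hyz
        · exact (hf.eq_of_reflTransGen hJ hsy hyz
            (((hS z).1 hzS).1.trans ((hS s).1 hs).2)).symm

-- Bichromatic arcs between `D` and its complement all leave `D`. Hence the non-`j` part of `D`
-- dominates the `j` part of the complement, and the `i` part of `D` dominates the non-`i` part of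
-- the complement; adding the two isoperimetric bounds cancels `|D|`. With excess `2 * colourCount f
-- k D - colourCount f k univ`, colour `i` exceeds colour `j` by at most 1.
open Classical in
theorem IsPredClosed.colourCount_le [Fintype G] [DecidableEq ι] (hJ : IsTournamentSet J)
    (hs : IsSimpleTournamentSet J) {D : Finset G} (hD : IsPredClosed J f D) {i j : ι}
    (hij : i ≠ j) (hi : 0 < colourCount f i D)
    (hj : colourCount f j D < colourCount f j Finset.univ) :
    2 * colourCount f i D + colourCount f j Finset.univ ≤
      colourCount f i Finset.univ + 2 * colourCount f j D + 1 := by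
  have hsplit : ∀ k : ι, colourCount f k D + ((Dᶜ).filter fun v => f v = k).card =
      colourCount f k Finset.univ := by
    intro k
    unfold colourCount
    rw [← Finset.card_union_of_disjoint, ← Finset.filter_union, Finset.union_compl]
    exact Finset.disjoint_filter_filter disjoint_compl_right
  have hsi := hsplit i
  have hsj := hsplit j
  have hDi := Finset.card_filter_add_card_filter_not (s := D) (fun v => f v = j)
  have hDj := Finset.card_filter_add_card_filter_not (s := Dᶜ) (fun v => f v = i)
  have hDc := Finset.card_add_card_compl D
  unfold colourCount at *
  have arc : ∀ u ∈ D, ∀ m ∈ Dᶜ, f u ≠ f m → m - u ∈ J := by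
    intro u hu m hm hc
    exact (BichromaticArc.of_not hJ hc fun h =>
      Finset.mem_compl.1 hm (hD _ _ h hu)).1
  obtain ⟨a, ha⟩ := Finset.card_pos.1 hi
  obtain ⟨b, hb⟩ := Finset.card_pos.1
    (show 0 < ((Dᶜ).filter fun v => f v = j).card by omega)
  have haD := Finset.mem_filter.1 ha
  have hbD := Finset.mem_filter.1 hb
  have h1 := Dominates.card_le hJ hs (U := D.filter fun v => ¬ f v = j)
    (M := (Dᶜ).filter fun v => f v = j)
    ⟨a, Finset.mem_filter.2 ⟨haD.1, by rw [haD.2]; exact hij⟩⟩ ⟨b, hb⟩ (by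
      intro u hu m hm
      obtain ⟨hu, hu'⟩ := Finset.mem_filter.1 hu
      obtain ⟨hm, hm'⟩ := Finset.mem_filter.1 hm
      exact arc u hu m hm (hm' ▸ hu'))
  have h2 := Dominates.card_le hJ hs (U := D.filter fun v => f v = i)
    (M := (Dᶜ).filter fun v => ¬ f v = i)
    ⟨a, ha⟩ ⟨b, Finset.mem_filter.2 ⟨hbD.1, by rw [hbD.2]; exact hij.symm⟩⟩ (by
      intro u hu m hm
      obtain ⟨hu, hu'⟩ := Finset.mem_filter.1 hu
      obtain ⟨hm, hm'⟩ := Finset.mem_filter.1 hm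
      exact arc u hu m hm (hu' ▸ fun e => hm' e.symm))
  omega

open Classical in
/-- In a simple Cayley tournament, a colouring with three colours and no rainbow directed triangle
has a colour class with just one vertex. -/
theorem RainbowTriangleFree.exists_singleton_class [Fintype G] (hJ : IsTournamentSet J)
    (hs : IsSimpleTournamentSet J) {f : G → Fin 3} (hf : RainbowTriangleFree J f)
    (hsurj : Function.Surjective f) : ∃ c, ∀ v, f v = f c → v = c := by
  let T : Fin 3 → ℕ := fun i => colourCount f i Finset.univ
  have hT : ∀ i, 0 < T i := fun i => by
    obtain ⟨v, rfl⟩ := hsurj i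
    exact colourCount_pos (Finset.mem_univ v)
  have hmono : ∀ i (D : Finset G), colourCount f i D ≤ T i := fun i D =>
    Finset.card_le_card (Finset.filter_subset_filter _ (Finset.subset_univ D))
  have hzero : ∀ i (S : Finset G), (∀ s ∈ S, f s ≠ i) → colourCount f i S = 0 := fun i S h =>
    Finset.card_eq_zero.2 (Finset.filter_eq_empty_iff.2 fun {s} hs => h s hs)
  have htwo : ∀ (S : Finset G), (∀ s ∈ S, ∃ t ∈ S, t ≠ s ∧ f t = f s) → ∀ s ∈ S,
      2 ≤ colourCount f (f s) S := by
    intro S h s hs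
    obtain ⟨t, ht, hts, hc⟩ := h s hs
    exact Finset.one_lt_card.2 ⟨t, Finset.mem_filter.2 ⟨ht, hc⟩, s,
      Finset.mem_filter.2 ⟨hs, rfl⟩, hts⟩
  have hle : ∀ (D : Finset G), IsPredClosed J f D → ∀ i j, i ≠ j → 0 < colourCount f i D →
      colourCount f j D < T j →
      2 * colourCount f i D + T j ≤ T i + 2 * colourCount f j D + 1 :=
    fun D hD i j hij hi hj => hD.colourCount_le hJ hs hij hi hj
  have hex : ∀ (D : Finset G) i, colourCount f i D < T i → ∃ v, v ∉ D := by
    intro D i h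
    by_contra hc
    push Not at hc
    rw [Finset.eq_univ_iff_forall.2 hc] at h
    exact lt_irrefl _ h
  -- The last moment at which a colour `C` is still absent: by maximality, adding the next component
  -- completes the palette.
  obtain ⟨D, hDm, hmax⟩ := Finset.exists_max_image
    (Finset.univ.filter fun D : Finset G => IsPredClosed J f D ∧ ∃ i, colourCount f i D = 0)
    Finset.card ⟨∅, Finset.mem_filter.2 ⟨Finset.mem_univ _, fun _ _ _ h => by simp at h, 0, rfl⟩⟩
  obtain ⟨-, hD, C, hC⟩ := Finset.mem_filter.1 hDm
  obtain ⟨S, hdis, hDS, hS⟩ := hD.exists_step hJ hf (hex D C (by rw [hC]; exact hT C))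
  have hSne : S.Nonempty := by
    rcases hS with ⟨s, rfl⟩ | h
    · exact ⟨s, by simp⟩
    · exact h.1
  have hall : ∀ i, 0 < colourCount f i D + colourCount f i S := by
    intro i
    by_contra h
    have h0 : colourCount f i (D ∪ S) = 0 := by rw [colourCount_union hdis]; omega
    have := hmax (D ∪ S) (Finset.mem_filter.2 ⟨Finset.mem_univ _, hDS, i, h0⟩)
    rw [Finset.card_union_of_disjoint hdis] at this
    have := hSne.card_pos
    omega
  have hCS : 0 < colourCount f C S := by have := hall C; omega
  obtain ⟨s₀, hs₀⟩ := Finset.card_pos.1 hCS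
  obtain ⟨hs₀S, hs₀C⟩ := Finset.mem_filter.1 hs₀
  rcases hS with ⟨s, rfl⟩ | ⟨-, ⟨A, hA⟩, htwin⟩
  · obtain rfl : s₀ = s := by simpa using hs₀S
    by_cases hc1 : T C = 1
    · refine ⟨s₀, fun v hv => ?_⟩
      obtain ⟨w, hw⟩ := Finset.card_eq_one.1 (show (Finset.univ.filter fun v => f v = C).card = 1
        from hc1)
      have h1 : v ∈ Finset.univ.filter fun v => f v = C := by simp [hv, hs₀C]
      have h2 : s₀ ∈ Finset.univ.filter fun v => f v = C := by simp [hs₀C]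
      rw [hw, Finset.mem_singleton] at h1 h2
      rw [h1, h2]
    exfalso
    have hTC := hT C
    have cS : ∀ i, colourCount f i {s₀} = if C = i then 1 else 0 := fun i => by
      rw [colourCount_singleton, hs₀C]
    -- Adding `s₀` moves the excess of `C` from `-T C` to `2 - T C`. The bounds before and after pin
    -- every other excess at exactly `1 - T C`; `T C ≥ 2` keeps those colours incomplete.
    have hD' : ∀ i, i ≠ C → 2 * colourCount f i D + T C = T i + 1 ∧
        colourCount f i (D ∪ {s₀}) = colourCount f i D ∧ 0 < colourCount f i D ∧
        colourCount f i D < T i := by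
      intro i hi
      have e : colourCount f i {s₀} = 0 := by rw [cS, if_neg (Ne.symm hi)]
      have hpos := hall i
      have h1 := hle D hD i C hi (by omega) (by omega)
      have hlt : colourCount f i D < T i := by have := hmono i D; omega
      have e' : colourCount f i (D ∪ {s₀}) = colourCount f i D := by
        rw [colourCount_union hdis, e, add_zero]
      have eC : colourCount f C (D ∪ {s₀}) = 1 := by
        rw [colourCount_union hdis, cS, if_pos rfl, hC]
      have h2 := hle _ hDS C i (Ne.symm hi) (by omega) (by omega)
      refine ⟨by omega, e', by omega, hlt⟩
    have eC : colourCount f C (D ∪ {s₀}) = 1 := by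
      rw [colourCount_union hdis, cS, if_pos rfl, hC]
    obtain ⟨A, B, hAC, hBC, hAB, hABC⟩ : ∃ A B : Fin 3, A ≠ C ∧ B ≠ C ∧ A ≠ B ∧
        ∀ i, i = A ∨ i = B ∨ i = C := by
      clear * -
      revert C
      decide
    obtain ⟨a1, a2, a3, a4⟩ := hD' A hAC
    obtain ⟨b1, b2, b3, b4⟩ := hD' B hBC
    -- The excesses are now `1 - T C`, `1 - T C`, `2 - T C`, with no colour exhausted. One more
    -- vertex raises one excess by 2; a larger component raises one by at least 4 and leaves colour
    -- `X` fixed. Either way some gap exceeds 1.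
    obtain ⟨S₂, hdis₂, hDS₂, hS₂⟩ := hDS.exists_step hJ hf (hex _ A (by omega))
    have hu := fun i => colourCount_union (f := f) hdis₂ i
    have hle₂ := hle _ hDS₂
    have huA := hu A
    have huB := hu B
    have huC := hu C
    have hmA := hmono A (D ∪ {s₀} ∪ S₂)
    have hmB := hmono B (D ∪ {s₀} ∪ S₂)
    have hmC := hmono C (D ∪ {s₀} ∪ S₂)
    have hAB' := hle₂ A B hAB
    have hBA' := hle₂ B A hAB.symm
    have hAC' := hle₂ A C hAC
    have hCA' := hle₂ C A hAC.symm
    have hBC' := hle₂ B C hBC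
    have hCB' := hle₂ C B hBC.symm
    rcases hS₂ with ⟨t, rfl⟩ | ⟨⟨t, ht⟩, ⟨X, hX⟩, htwin⟩
    · have hA1 := colourCount_singleton (f := f) A t
      have hB1 := colourCount_singleton (f := f) B t
      have hC1 := colourCount_singleton (f := f) C t
      rcases hABC (f t) with h | h | h
      · rw [if_pos h] at hA1
        rw [if_neg (h ▸ hAB)] at hB1
        rw [if_neg (h ▸ hAC)] at hC1
        omega
      · rw [if_neg (h ▸ hAB.symm)] at hA1
        rw [if_pos h] at hB1
        rw [if_neg (h ▸ hBC)] at hC1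
        omega
      · rw [if_neg (h ▸ hAC.symm)] at hA1
        rw [if_neg (h ▸ hBC.symm)] at hB1
        rw [if_pos h] at hC1
        omega
    · have hX0 := hzero X S₂ hX
      have ht2 := htwo S₂ htwin t ht
      have htX := hX t ht
      rcases hABC (f t) with h | h | h <;> rw [h] at ht2 htX <;>
        rcases hABC X with rfl | rfl | rfl <;> first | exact absurd rfl htX | omega
  · exfalso
    have hAC : A ≠ C := fun e => hA s₀ hs₀S (hs₀C.trans e.symm)
    have hA0 := hzero A S hA
    have hC2 := htwo S htwin s₀ hs₀S
    rw [hs₀C] at hC2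
    have hposA := hall A
    have hTC := hT C
    -- The excess of `A` is at most `1 - T C` and does not change, while that of `C` jumps to at
    -- least `4 - T C`.
    have h1 := hle D hD A C hAC (by omega) (by omega)
    have eA := colourCount_union (f := f) hdis A
    have eC := colourCount_union (f := f) hdis C
    have := hmono C (D ∪ S)
    have := hmono A D
    have h2 := hle _ hDS C A hAC.symm (by omega) (by omega)
    omega

end Rainbow

section Triangles

variable {G : Type*} [AddCommGroup G] {ι : Type*} {J : Set G}

/-- A colouring of the arcs of the Cayley digraph of `J` which is constant on directed triangles. -/
def TriangleConstant (J : Set G) (c : G → G → ι) : Prop :=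
  ∀ u v w, v - u ∈ J → w - v ∈ J → u - w ∈ J → c u v = c v w

/-- The arcs reachable from `z → u` through directed triangles sharing arcs. -/
inductive TriangleReach (J : Set G) (z u : G) : G → G → Prop
  | base : TriangleReach J z u z u
  | left {p q t : G} : TriangleReach J z u p q → q - p ∈ J → t - q ∈ J → p - t ∈ J →
      TriangleReach J z u q t
  | right {p q t : G} : TriangleReach J z u p q → q - p ∈ J → t - q ∈ J → p - t ∈ J →
      TriangleReach J z u t p

theorem TriangleReach.adj {z u p q : G} (hzu : u - z ∈ J) (h : TriangleReach J z u p q) :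
    q - p ∈ J := by
  cases h <;> assumption

/-- Lets the vertex set of a class of arcs be described by tails alone. -/
theorem TriangleReach.swap {z u w p q : G} (hzu : u - z ∈ J) (huw : w - u ∈ J)
    (hwz : z - w ∈ J) (h : TriangleReach J z u p q) : ∃ t, TriangleReach J z u q t := by
  cases h with
  | base => exact ⟨w, .left .base hzu huw hwz⟩
  | left h h₁ h₂ h₃ => exact ⟨_, .right h h₁ h₂ h₃⟩
  | right h h₁ h₂ h₃ => exact ⟨_, h⟩

/-- If `x → p` and `q → x` for a reached arc `p → q`, then `x` completes a triangle and is itself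
reached. So for an unreached `x`, domination of one vertex passes cyclically around each triangle.
-/
theorem TriangleReach.homogeneous (hJ : IsTournamentSet J) {z u w x p q : G} (hzu : u - z ∈ J)
    (huw : w - u ∈ J) (hwz : z - w ∈ J) (hx : ∀ p q, TriangleReach J z u p q → x ≠ p)
    (h : TriangleReach J z u p q) : (p - x ∈ J ↔ z - x ∈ J) ∧ (q - x ∈ J ↔ z - x ∈ J) := by
  have step : ∀ p q, TriangleReach J z u p q → q - x ∉ J → p - x ∉ J := by
    intro p q hpq hqx hpx
    obtain ⟨t, ht⟩ := hpq.swap hzu huw hwz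
    have hxq : x - q ∈ J := (hJ.adj_or (hx q t ht)).resolve_left hqx
    exact hx x p (.right hpq (hpq.adj hzu) hxq hpx) rfl
  have cyc : ∀ p q t, TriangleReach J z u p q → t - q ∈ J → p - t ∈ J →
      (p - x ∈ J ↔ q - x ∈ J) ∧ (q - x ∈ J ↔ t - x ∈ J) := by
    intro p q t h h₂ h₃
    have h₁ := h.adj hzu
    have a := step _ _ h
    have b := step _ _ (.left h h₁ h₂ h₃)
    have c := step _ _ (.right h h₁ h₂ h₃)
    tauto
  induction h with
  | base => exact ⟨Iff.rfl, (cyc _ _ _ .base huw hwz).1.symm⟩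
  | left h _ h₂ h₃ ih => have := cyc _ _ _ h h₂ h₃; tauto
  | right h _ h₂ h₃ ih => have := cyc _ _ _ h h₂ h₃; tauto

/-- A simple Cayley tournament has no nontrivial homogeneous set of vertices. -/
theorem IsSimpleTournamentSet.eq_univ_of_homogeneous [Fintype G] (hJ : IsTournamentSet J)
    (hs : IsSimpleTournamentSet J) {S : Set G} {a b : G} (ha : a ∈ S) (hb : b ∈ S) (hab : a ≠ b)
    (h : ∀ x ∉ S, (∀ s ∈ S, s - x ∈ J) ∨ ∀ s ∈ S, x - s ∈ J) (x : G) : x ∈ S := by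
  classical
  by_contra hx
  let F : Finset G := Finset.univ.filter (· ∈ S)
  let M : Finset G := Finset.univ.filter fun y => y ∉ S ∧ ∀ s ∈ S, y - s ∈ J
  let M' : Finset G := Finset.univ.filter fun y => y ∉ S ∧ ∀ s ∈ S, s - y ∈ J
  have hF : 1 < F.card := Finset.one_lt_card.2 ⟨a, by simpa [F], b, by simpa [F], hab⟩
  have hFne : F.Nonempty := ⟨a, by simpa [F]⟩
  have hcov : Fintype.card G ≤ F.card + (M.card + M'.card) := by
    rw [← Finset.card_univ]
    refine le_trans (Finset.card_le_card (t := F ∪ (M ∪ M')) ?_)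
      ((Finset.card_union_le _ _).trans (Nat.add_le_add_left (Finset.card_union_le _ _) _))
    intro y _
    by_cases hy : y ∈ S
    · exact Finset.mem_union_left _ (by simpa [F])
    · refine Finset.mem_union_right _ ?_
      rcases h y hy with h' | h'
      · exact Finset.mem_union_right _ (Finset.mem_filter.2 ⟨Finset.mem_univ _, hy, h'⟩)
      · exact Finset.mem_union_left _ (Finset.mem_filter.2 ⟨Finset.mem_univ _, hy, h'⟩)
  have h1 : M.Nonempty → 2 * (F.card + M.card) ≤ Fintype.card G + 1 := fun hM =>
    Dominates.card_le hJ hs hFne hM fun s hs' y hy =>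
      (Finset.mem_filter.1 hy).2.2 s (Finset.mem_filter.1 hs').2
  have h2 : M'.Nonempty → 2 * (M'.card + F.card) ≤ Fintype.card G + 1 := fun hM =>
    Dominates.card_le hJ hs hM hFne fun y hy s hs' =>
      (Finset.mem_filter.1 hy).2.2 s (Finset.mem_filter.1 hs').2
  -- If both are nonempty, the two bounds add up to `2|F| + |M| + |M'| ≤ |G| + 1`, against `hcov`
  -- and `|F| ≥ 2`.
  rcases M.eq_empty_or_nonempty with e | e <;> rcases M'.eq_empty_or_nonempty with e' | e'
  · have hx' : x ∈ M ∪ M' := by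
      rcases h x hx with h' | h'
      · exact Finset.mem_union_right _ (Finset.mem_filter.2 ⟨Finset.mem_univ _, hx, h'⟩)
      · exact Finset.mem_union_left _ (Finset.mem_filter.2 ⟨Finset.mem_univ _, hx, h'⟩)
    rw [e, e'] at hx'
    simp at hx'
  · have := h2 e'
    rw [e, Finset.card_empty] at hcov
    omega
  · have := h1 e
    rw [e', Finset.card_empty] at hcov
    omega
  · have := h1 e
    have := h2 e'
    omega

/-- The triangles reachable from a triangle lying between the ends of an arc `r → r'` of another
colour stay there. -/
theorem TriangleConstant.not_between [Fintype G] (hJ : IsTournamentSet J)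
    (hs : IsSimpleTournamentSet J) {c : G → G → ι} (hc : TriangleConstant J c) {z u w r r' : G}
    (hzu : u - z ∈ J) (huw : w - u ∈ J) (hwz : z - w ∈ J) (hr : r' - r ∈ J)
    (hcol : c z u ≠ c r r') (hz : r - z ∈ J ∧ z - r' ∈ J) (hu : r - u ∈ J ∧ u - r' ∈ J) :
    False := by
  have key : ∀ p q, TriangleReach J z u p q →
      c p q = c z u ∧ (r - p ∈ J ∧ p - r' ∈ J) ∧ (r - q ∈ J ∧ q - r' ∈ J) := by
    -- If `t` left the region between `r'` and `r`, a chain of triangles would link the colour of `p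
    -- → q` to that of `r → r'`.
    have step : ∀ p q t, q - p ∈ J → t - q ∈ J → p - t ∈ J → c p q = c z u →
        (r - p ∈ J ∧ p - r' ∈ J) → (r - q ∈ J ∧ q - r' ∈ J) → r - t ∈ J ∧ t - r' ∈ J := by
      intro p q t h₁ h₂ h₃ hpq hp hq
      have e1 := hc _ _ _ h₁ h₂ h₃
      have e2 := hc _ _ _ h₂ h₃ h₁
      constructor
      · by_contra hrt
        rcases eq_or_ne t r with rfl | hne
        · exact hJ.adj_asymm h₃ hp.1
        · have hrt := (hJ.adj_or hne).resolve_left hrt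
          have e3 := hc _ _ _ h₃ hp.1 hrt
          have e4 := hc _ _ _ hp.1 hr hp.2
          exact hcol (by rw [← hpq, e1, e2, e3, e4])
      · by_contra hrt
        rcases eq_or_ne t r' with rfl | hne
        · exact hJ.adj_asymm h₂ hq.2
        · have hrt := (hJ.adj_or hne).resolve_right hrt
          have e3 := hc _ _ _ hq.2 h₂ hrt
          have e4 := hc _ _ _ hr hq.2 hq.1
          exact hcol (by rw [← hpq, e1, ← e3, e4])
    intro p q h
    induction h with
    | base => exact ⟨rfl, hz, hu⟩
    | left h h₁ h₂ h₃ ih =>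
      exact ⟨(hc _ _ _ h₁ h₂ h₃).symm.trans ih.1, ih.2.2,
        step _ _ _ h₁ h₂ h₃ ih.1 ih.2.1 ih.2.2⟩
    | right h h₁ h₂ h₃ ih =>
      exact ⟨(hc _ _ _ h₃ h₁ h₂).trans ih.1, step _ _ _ h₁ h₂ h₃ ih.1 ih.2.1 ih.2.2, ih.2.1⟩
  have hne : z ≠ u := by
    rintro rfl
    rw [sub_self] at hzu
    exact hJ.zero_notMem hzu
  -- The reached vertices form a homogeneous set, hence include `r` itself, which `key` forbids.
  have := hs.eq_univ_of_homogeneous hJ (S := {p | ∃ q, TriangleReach J z u p q}) (a := z) (b := u)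
    ⟨u, .base⟩ ⟨w, .left .base hzu huw hwz⟩ hne (by
      intro x hx
      have hx' : ∀ p q, TriangleReach J z u p q → x ≠ p := by
        rintro p q h rfl
        exact hx ⟨q, h⟩
      have hom := fun p q h =>
        (TriangleReach.homogeneous (p := p) (q := q) hJ hzu huw hwz hx' h).1
      by_cases hzx : z - x ∈ J
      · left
        rintro p ⟨q, h⟩
        exact (hom p q h).2 hzx
      · right
        rintro p ⟨q, h⟩
        exact (hJ.adj_or (hx' p q h)).resolve_left fun h' => hzx ((hom p q h).1 h')) r
  obtain ⟨q, hq⟩ := this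
  have := (key r q hq).2.1.1
  rw [sub_self] at this
  exact hJ.zero_notMem this

/-- In a simple Cayley tournament two directed triangles with a common vertex have equal colours,
for any arc colouring which is constant on directed triangles. -/
theorem TriangleConstant.eq_of_common_vertex [Fintype G] (hJ : IsTournamentSet J)
    (hs : IsSimpleTournamentSet J) {c : G → G → ι} (hc : TriangleConstant J c) {z u w r r' : G}
    (hzu : u - z ∈ J) (huw : w - u ∈ J) (hwz : z - w ∈ J)
    (hzr : r - z ∈ J) (hr : r' - r ∈ J) (hrz : z - r' ∈ J) : c z u = c z r := by
  by_contra hcol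
  have a1 := hc _ _ _ hzu huw hwz
  have a2 := hc _ _ _ huw hwz hzu
  have b1 := hc _ _ _ hzr hr hrz
  have b2 := hc _ _ _ hr hrz hzr
  -- The opposite orientation would create a triangle sharing an arc with each of the two given
  -- ones.
  have hwr : r - w ∈ J := by
    by_contra h
    rcases eq_or_ne w r with rfl | hne
    · exact hJ.adj_asymm hwz hzr
    · have := hc _ _ _ hwz hzr ((hJ.adj_or hne).resolve_left h)
      exact hcol (by rw [a1, a2, this])
  have hru : u - r' ∈ J := by
    by_contra h
    rcases eq_or_ne r' u with rfl | hne
    · exact hJ.adj_asymm hzu hrz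
    · have := hc _ _ _ hrz hzu ((hJ.adj_or hne).resolve_left h)
      exact hcol (by rw [← this, ← b2, ← b1])
  by_cases hur : r - u ∈ J
  · exact hc.not_between hJ hs hzu huw hwz hr (fun e => hcol (e.trans b1.symm)) ⟨hzr, hrz⟩
      ⟨hur, hru⟩
  · rcases eq_or_ne u r with rfl | hne
    · exact hcol rfl
    · have hur := (hJ.adj_or hne).resolve_left hur
      exact hc.not_between hJ hs hzr hr hrz huw (fun e => hcol (a1.trans e.symm)) ⟨hzu, hwz⟩
        ⟨hur, hwr⟩

/-- Every element of the connection set of a finite Cayley tournament is in a directed triangle. -/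
theorem IsTournamentSet.exists_triangle [Finite G] (hJ : IsTournamentSet J) {x : G} (hx : x ∈ J) :
    ∃ y ∈ J, -(x + y) ∈ J := by
  by_contra h
  push Not at h
  -- Without a triangle on `x`, `J` is closed under adding `x`, so it contains every positive
  -- multiple of `x`, including 0.
  have step : ∀ y ∈ J, x + y ∈ J := by
    intro y hy
    refine (hJ.total (x + y) fun e => ?_).resolve_right (h y hy)
    exact hJ.neg_notMem x hx (by rwa [neg_eq_of_add_eq_zero_right e])
  have all : ∀ k : ℕ, (k + 1) • x ∈ J := by
    intro k
    induction k with
    | zero => simpa using hx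
    | succ k ih => rw [succ_nsmul']; exact step _ ih
  have hpos : 0 < addOrderOf x := addOrderOf_pos x
  have := all (addOrderOf x - 1)
  rw [Nat.sub_add_cancel hpos, addOrderOf_nsmul_eq_zero] at this
  exact hJ.zero_notMem this

/-- In a simple Cayley tournament, a colouring without rainbow directed triangles in which some
vertex is the only one of its colour has at most two colours. -/
theorem RainbowTriangleFree.eq_of_singleton_class [Fintype G] (hJ : IsTournamentSet J)
    (hs : IsSimpleTournamentSet J) {f : G → ι} (hf : RainbowTriangleFree J f) {s : G}
    (hsing : ∀ v, f v = f s → v = s) {a b : G} (ha : a ≠ s) (hb : b ≠ s) : f a = f b := by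
  have inout : ∀ x ∈ J, ∀ y ∈ J, -(x + y) ∈ J → f (s - x) = f (s + y) := by
    intro x hx y hy hxy
    have h1 : f s ≠ f (s - x) := fun e => by
      have := hsing _ e.symm
      rw [sub_eq_self] at this
      exact hJ.zero_notMem (this ▸ hx)
    have h2 : f s ≠ f (s + y) := fun e => by
      have := hsing _ e.symm
      rw [add_eq_left] at this
      exact hJ.zero_notMem (this ▸ hy)
    rcases hf (s - x) s (s + y) (by simpa using hx) (by simpa using hy)
      (by convert hxy using 1; abel) with h | h | h
    · exact absurd h.symm h1
    · exact absurd h h2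
    · exact h.symm
  have outout : ∀ x ∈ J, ∀ y ∈ J, -(x + y) ∈ J → f (s + x) = f (s + y) := by
    intro x hx y hy hxy
    have h1 := inout _ hxy x hx (by convert hy using 1; abel)
    have h2 := inout _ hxy y hy (by convert hx using 1; abel)
    rw [← h1, h2]
  -- Translating each arc to start at `s` turns the vertex colours around `s` into an arc colouring
  -- constant on triangles.
  have hc : TriangleConstant J (fun u v => f (s + (v - u))) := by
    intro u v w h1 h2 h3
    exact outout _ h1 _ h2 (by convert h3 using 1; abel)
  have rep : ∀ a, a ≠ s → ∃ x ∈ J, f (s + x) = f a := by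
    intro a ha
    rcases hJ.total (a - s) (sub_ne_zero.2 ha) with h | h
    · exact ⟨a - s, h, by simp⟩
    · obtain ⟨y, hy, hxy⟩ := hJ.exists_triangle h
      exact ⟨y, hy, by rw [← inout _ h y hy hxy]; simp⟩
  obtain ⟨x, hx, hxa⟩ := rep a ha
  obtain ⟨y, hy, hyb⟩ := rep b hb
  obtain ⟨x', hx', hxx⟩ := hJ.exists_triangle hx
  obtain ⟨y', hy', hyy⟩ := hJ.exists_triangle hy
  have := hc.eq_of_common_vertex hJ hs (z := 0) (u := x) (w := x + x') (r := y) (r' := y + y')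
    (by simpa using hx) (by simpa using hx') (by simpa using hxx) (by simpa using hy)
    (by simpa using hy') (by simpa using hyy)
  simp only [sub_zero] at this
  rw [← hxa, ← hyb, this]

/-- Simple Cayley tournaments are tight: a colouring without rainbow directed triangles has at
most two colours. -/
theorem RainbowTriangleFree.not_three_colours [Fintype G] (hJ : IsTournamentSet J)
    (hs : IsSimpleTournamentSet J) {f : G → ι} (hf : RainbowTriangleFree J f) {x y z : G}
    (hxy : f x ≠ f y) (hyz : f y ≠ f z) (hxz : f x ≠ f z) : False := by
  classical
  let g : G → Fin 3 := fun v => if f v = f x then 0 else if f v = f y then 1 else 2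
  have hg : ∀ u v, f u = f v → g u = g v := fun u v h => by simp only [g, h]
  have hgf : RainbowTriangleFree J g := fun u v w h1 h2 h3 =>
    (hf u v w h1 h2 h3).imp (hg _ _) (Or.imp (hg _ _) (hg _ _))
  have gx : g x = 0 := by simp [g]
  have gy : g y = 1 := by simp [g, hxy.symm]
  have gz : g z = 2 := by simp [g, hxz.symm, hyz.symm]
  obtain ⟨s, hsing⟩ := hgf.exists_singleton_class hJ hs (fun i => by
    fin_cases i
    exacts [⟨x, gx⟩, ⟨y, gy⟩, ⟨z, gz⟩])
  have key := fun a b ha hb => hgf.eq_of_singleton_class hJ hs hsing (a := a) (b := b) ha hb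
  by_cases h1 : x = s
  · have := key y z (fun e => hxy (congrArg f (h1.trans e.symm)))
      (fun e => hxz (congrArg f (h1.trans e.symm)))
    rw [gy, gz] at this
    exact absurd this (by decide)
  · by_cases h2 : y = s
    · have := key x z h1 (fun e => hyz (congrArg f (h2.trans e.symm)))
      rw [gx, gz] at this
      exact absurd this (by decide)
    · have := key x y h1 h2
      rw [gx, gy] at this
      exact absurd this (by decide)

end Triangles

/-! ### Modules, quotients and the induction. -/

section Quotient

variable {G : Type*} [AddCommGroup G] {ι : Type*} {J : Set G}

/-- The colouring `f` admits a height function increasing along the bichromatic arcs, so that these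
arcs form no directed cycle. -/
def AcyclicColouring (J : Set G) (f : G → ι) : Prop :=
  ∃ h : G → ℤ, ∀ u v, BichromaticArc J f u v → h u < h v

theorem IsTournamentSet.restrict (hJ : IsTournamentSet J) (H : AddSubgroup G) :
    IsTournamentSet {h : H | (h : G) ∈ J} where
  zero_notMem := hJ.zero_notMem
  neg_notMem x hx := hJ.neg_notMem _ hx
  total x hx := hJ.total x (by simpa using hx)

theorem RainbowTriangleFree.restrict {f : G → ι} (hf : RainbowTriangleFree J f)
    (H : AddSubgroup G) (x : G) :
    RainbowTriangleFree {h : H | (h : G) ∈ J} (fun h => f (x + h)) := by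
  intro u v w h1 h2 h3
  exact hf _ _ _ (by simpa using h1) (by simpa using h2) (by simpa using h3)

open Classical in
/-- An acyclic colouring of a subgroup which is a module extends to the whole group with one more
colour. -/
theorem AcyclicColouring.extend (hJ : IsTournamentSet J) {H : AddSubgroup G}
    [Finite H] (hH : IsModuleSubgroup J H) {g : H → ℕ}
    (hg : AcyclicColouring {h : H | (h : G) ∈ J} g) :
    AcyclicColouring J (fun v => if hv : v ∈ H then g ⟨v, hv⟩ + 1 else 0) := by
  obtain ⟨h, hh⟩ := hg
  obtain ⟨b, hb⟩ := (Set.finite_range h).bddAbove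
  obtain ⟨a, ha⟩ := (Set.finite_range h).bddBelow
  have hb' : ∀ x, h x ≤ b := fun x => hb ⟨x, rfl⟩
  have ha' : ∀ x, a ≤ h x := fun x => ha ⟨x, rfl⟩
  -- As `H` is a module, outside vertices in `J` are dominated by all of `H` and the others dominate
  -- all of `H`; they are placed above and below its heights.
  refine ⟨fun v => if hv : v ∈ H then h ⟨v, hv⟩ else if v ∈ J then b + 1 else a - 1, ?_⟩
  rintro u v ⟨huv, hc⟩
  by_cases hu : u ∈ H <;> by_cases hv : v ∈ H <;> simp only [hu, hv, dite_true, dite_false] at hc ⊢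
  · exact hh _ _ ⟨by simpa using huv, fun e => hc (by rw [e])⟩
  · have : v ∈ J := by
      have := hH (v - u) huv (fun h' => hv (by simpa using H.add_mem h' hu)) u hu
      simpa using this
    rw [if_pos this]
    have := hb' ⟨u, hu⟩
    omega
  · have : u ∉ J := by
      intro hu'
      have := hH u hu' hu (-v) (H.neg_mem hv)
      exact hJ.adj_asymm huv (by rwa [sub_eq_add_neg])
    rw [if_neg this]
    have := ha' ⟨v, hv⟩
    omega
  · exact absurd rfl hc

/-- The connection set of the quotient of a Cayley tournament by a module. -/
def quotientSet (J : Set G) (H : AddSubgroup G) : Set (G ⧸ H) :=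
  {q | ∃ j ∈ J, j ∉ H ∧ (j : G ⧸ H) = q}

theorem mem_of_mk_mem_quotientSet {H : AddSubgroup G} (hH : IsModuleSubgroup J H) {x : G}
    (hx : (x : G ⧸ H) ∈ quotientSet J H) : x ∈ J ∧ x ∉ H := by
  obtain ⟨j, hj, hjH, hjx⟩ := hx
  have hmem : -j + x ∈ H := QuotientAddGroup.eq.1 hjx
  constructor
  · have := hH j hj hjH _ hmem
    simpa using this
  · intro hxH
    exact hjH (by simpa using (H.add_mem_cancel_right hxH).1 hmem)

theorem IsTournamentSet.quotient (hJ : IsTournamentSet J) {H : AddSubgroup G}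
    (hH : IsModuleSubgroup J H) : IsTournamentSet (quotientSet J H) where
  zero_notMem h := (mem_of_mk_mem_quotientSet hH (x := 0) h).2 H.zero_mem
  neg_notMem q hq hq' := by
    obtain ⟨x, rfl⟩ := QuotientAddGroup.mk_surjective q
    exact hJ.neg_notMem x (mem_of_mk_mem_quotientSet hH hq).1
      (mem_of_mk_mem_quotientSet hH (x := -x) hq').1
  total q hq := by
    obtain ⟨x, rfl⟩ := QuotientAddGroup.mk_surjective q
    have hxH : x ∉ H := fun h => hq ((QuotientAddGroup.eq_zero_iff x).2 h)
    rcases hJ.total x (fun e => hxH (e ▸ H.zero_mem)) with h | h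
    · exact Or.inl ⟨x, h, hxH, rfl⟩
    · exact Or.inr ⟨-x, h, fun h' => hxH (by simpa using H.neg_mem h'), rfl⟩

/-- The preimage of a module subgroup of the quotient is a module containing `H`, so maximality
leaves only `H` and the whole group. -/
theorem IsSimpleTournamentSet.quotient {H : AddSubgroup G} (hH : IsModuleSubgroup J H)
    (hmax : ∀ K : AddSubgroup G, IsModuleSubgroup J K → H < K → K = ⊤) :
    IsSimpleTournamentSet (quotientSet J H) := by
  intro K hK
  have hle : H ≤ K.comap (QuotientAddGroup.mk' H) := by
    intro x hx
    have : QuotientAddGroup.mk' H x = 0 := (QuotientAddGroup.eq_zero_iff x).2 hx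
    rw [AddSubgroup.mem_comap, this]
    exact K.zero_mem
  have hmod : IsModuleSubgroup J (K.comap (QuotientAddGroup.mk' H)) := by
    intro j hj hjK k hk
    exact (mem_of_mk_mem_quotientSet hH (x := j + k)
      (hK (j : G ⧸ H) ⟨j, hj, fun h => hjK (hle h), rfl⟩ hjK _ hk)).1
  rcases hle.eq_or_lt with h | h
  · left
    rw [eq_bot_iff]
    intro q hq
    obtain ⟨x, rfl⟩ := QuotientAddGroup.mk_surjective q
    have : x ∈ H := by rw [h]; exact hq
    exact (QuotientAddGroup.eq_zero_iff x).2 this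
  · right
    rw [eq_top_iff]
    intro q _
    obtain ⟨x, rfl⟩ := QuotientAddGroup.mk_surjective q
    have : x ∈ K.comap (QuotientAddGroup.mk' H) := by rw [hmax _ hmod h]; trivial
    exact this

/-- If the quotient by a module is simple, three vertices in distinct cosets do not have three
distinct colours. -/
theorem RainbowTriangleFree.eq_of_distinct_cosets [Finite G] (hJ : IsTournamentSet J)
    {f : G → ι} (hf : RainbowTriangleFree J f) {H : AddSubgroup G} (hH : IsModuleSubgroup J H)
    (hs : IsSimpleTournamentSet (quotientSet J H)) {x y z : G} (hxy : (x : G ⧸ H) ≠ y)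
    (hyz : (y : G ⧸ H) ≠ z) (hxz : (x : G ⧸ H) ≠ z) : f x = f y ∨ f y = f z ∨ f x = f z := by
  classical
  have := Fintype.ofFinite (G ⧸ H)
  -- A section of the quotient map through `x`, `y`, `z`; arcs between cosets do not depend on
  -- representatives.
  let σ : G ⧸ H → G := fun q => if q = x then x else if q = y then y else if q = z then z else q.out
  have hσ : ∀ q, (σ q : G ⧸ H) = q := by
    intro q
    dsimp only [σ]
    split_ifs with h1 h2 h3
    exacts [h1.symm, h2.symm, h3.symm, QuotientAddGroup.out_eq' q]
  have hσf : RainbowTriangleFree (quotientSet J H) (fun q => f (σ q)) := by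
    have lift : ∀ p q, q - p ∈ quotientSet J H → σ q - σ p ∈ J := by
      intro p q h
      refine (mem_of_mk_mem_quotientSet hH ?_).1
      rwa [QuotientAddGroup.mk_sub, hσ, hσ]
    intro u v w h1 h2 h3
    exact hf _ _ _ (lift _ _ h1) (lift _ _ h2) (lift _ _ h3)
  have sx : σ x = x := by simp [σ]
  have sy : σ y = y := by simp [σ, hxy.symm]
  have sz : σ z = z := by simp [σ, hxz.symm, hyz.symm]
  by_contra hcon
  push Not at hcon
  refine hσf.not_three_colours (hJ.quotient hH) hs (x := (x : G ⧸ H)) (y := y) (z := z) ?_ ?_ ?_ <;>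
    simp only [sx, sy, sz]
  exacts [hcon.1, hcon.2.1, hcon.2.2]

/-- If three vertices in distinct cosets never have three distinct colours, and there are at least
three cosets, then some coset misses at most one colour. -/
theorem exists_coset_ncard_range_le [Finite G] {f : G → ι} {H : AddSubgroup G}
    (h3 : ∀ a b : G ⧸ H, ∃ c, c ≠ a ∧ c ≠ b)
    (hf : ∀ x y z : G, (x : G ⧸ H) ≠ y → (y : G ⧸ H) ≠ z → (x : G ⧸ H) ≠ z →
      f x = f y ∨ f y = f z ∨ f x = f z) :
    ∃ x : G, (Set.range f).ncard ≤ (Set.range fun h : H => f (x + h)).ncard + 1 := by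
  classical
  -- Take a coset with the most colours. If it misses two, both sit in one other coset, or a
  -- forbidden triple appears.
  obtain ⟨x, hx⟩ := Finite.exists_max fun x : G => (Set.range fun h : H => f (x + h)).ncard
  have hcos : ∀ y h, h ∈ H → ((y + h : G) : G ⧸ H) = y := fun y h hh =>
    (QuotientAddGroup.mk_add_of_mem y hh)
  refine ⟨x, ?_⟩
  by_contra hlt
  have hsub : (Set.range fun h : H => f (x + h)) ⊆ Set.range f := by
    rintro _ ⟨h, rfl⟩
    exact ⟨_, rfl⟩
  have hd := Set.ncard_sdiff_add_ncard_of_subset hsub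
  obtain ⟨c₁, hc₁, c₂, hc₂, hne⟩ := (Set.one_lt_ncard (s := Set.range f \ _)).1
    (show 1 < (Set.range f \ Set.range fun h : H => f (x + h)).ncard by omega)
  obtain ⟨⟨y₁, rfl⟩, hy₁⟩ := hc₁
  obtain ⟨⟨y₂, rfl⟩, hy₂⟩ := hc₂
  have hmiss : ∀ y, f y ∉ (Set.range fun h : H => f (x + h)) → ∀ h : H, f (x + h) ≠ f y :=
    fun y hy h e => hy ⟨h, e⟩
  have hcx : ∀ y, f y ∉ (Set.range fun h : H => f (x + h)) → (x : G ⧸ H) ≠ y := by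
    intro y hy e
    exact hy ⟨⟨-x + y, QuotientAddGroup.eq.1 e⟩, by simp⟩
  have hyy : (y₁ : G ⧸ H) = y₂ := by
    by_contra hyy
    have hx0 := fun y hy => hmiss y hy 0
    simp only [ZeroMemClass.coe_zero, add_zero] at hx0
    rcases hf x y₁ y₂ (hcx _ hy₁) hyy (hcx _ hy₂) with h | h | h
    exacts [hx0 _ hy₁ h, hne h, hx0 _ hy₂ h]
  obtain ⟨q, hqx, hqy⟩ := h3 x y₁
  obtain ⟨z, rfl⟩ := QuotientAddGroup.mk_surjective q
  -- A third coset makes `x + H` monochromatic, since `f z` cannot equal both missing colours; the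
  -- coset of `y₁` then has more colours.
  have hz : ∀ h : H, f (x + h) = f z := by
    intro h
    have e := hcos x h h.2
    have a := hf (x + h) y₁ z (e ▸ hcx _ hy₁) hqy.symm (e ▸ hqx.symm)
    have b := hf (x + h) y₂ z (e ▸ hcx _ hy₂) (hyy ▸ hqy.symm) (e ▸ hqx.symm)
    rcases a with a | a | a
    · exact absurd a (hmiss _ hy₁ h)
    · rcases b with b | b | b
      · exact absurd b (hmiss _ hy₂ h)
      · exact absurd (a.trans b.symm) hne
      · exact b
    · exact a
  have h1 : (Set.range fun h : H => f (x + h)).ncard ≤ 1 := by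
    rw [Set.ncard_le_one]
    rintro _ ⟨a, rfl⟩ _ ⟨b, rfl⟩
    exact (hz a).trans (hz b).symm
  have h2 : 1 < (Set.range fun h : H => f (y₁ + h)).ncard :=
    (Set.one_lt_ncard (Set.toFinite _)).2 ⟨f y₁, ⟨0, by simp⟩, f y₂,
      ⟨⟨-y₁ + y₂, QuotientAddGroup.eq.1 hyy⟩, by simp⟩, hne⟩
  have := hx y₁
  omega

theorem IsTournamentSet.exists_third [Finite G] (hJ : IsTournamentSet J) (hne : ∃ x : G, x ≠ 0)
    (a b : G) : ∃ c, c ≠ a ∧ c ≠ b := by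
  obtain ⟨x, hx⟩ : ∃ x, x ∈ J := by
    obtain ⟨x, hx⟩ := hne
    rcases hJ.total x hx with h | h
    exacts [⟨_, h⟩, ⟨_, h⟩]
  have hx0 : x ≠ 0 := by rintro rfl; exact hJ.zero_notMem hx
  by_cases h : a + x = b
  · refine ⟨a - x, by simpa using hx0, fun e => ?_⟩
    have : x = -x := by
      have : a - x = a + x := e.trans h.symm
      rw [sub_eq_add_neg] at this
      exact (add_left_cancel this).symm
    exact hJ.neg_notMem x hx (this ▸ hx)
  · exact ⟨a + x, by simpa using hx0, h⟩

/-- In a finite abelian Cayley tournament, colourings without rainbow directed triangles have at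
most as many colours as acyclic colourings. -/
theorem RainbowTriangleFree.exists_acyclicColouring (n : ℕ) {G : Type*} [AddCommGroup G]
    [Finite G] (hn : Nat.card G = n) {J : Set G} (hJ : IsTournamentSet J) {f : G → ℕ}
    (hf : RainbowTriangleFree J f) :
    ∃ g : G → ℕ, AcyclicColouring J g ∧ (Set.range f).ncard ≤ (Set.range g).ncard := by
  classical
  induction n using Nat.strong_induction_on generalizing G with
  | _ n ih =>
  have := Fintype.ofFinite G
  by_cases h2 : (Set.range f).ncard ≤ 2
  · by_cases h1 : (Set.range f).ncard ≤ 1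
    · refine ⟨f, ⟨fun _ => 0, fun u v h => ?_⟩, le_rfl⟩
      exact absurd ((Set.ncard_le_one (Set.toFinite _)).1 h1 _ ⟨u, rfl⟩ _ ⟨v, rfl⟩) h.2
    · obtain ⟨_, ⟨u, rfl⟩, _, ⟨v, rfl⟩, hc⟩ := (Set.one_lt_ncard (Set.toFinite _)).1 (not_le.1 h1)
      obtain ⟨x, hx⟩ : ∃ x : G, x ≠ 0 := by
        by_contra h
        push Not at h
        exact hc (by rw [h u, h v])
      -- Isolating 0 is always acyclic: in-neighbours at height -1, out-neighbours at height 1.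
      refine ⟨fun v => if v = 0 then 0 else 1,
        ⟨fun v => if v = 0 then 0 else if v ∈ J then 1 else -1, ?_⟩, h2.trans ?_⟩
      · rintro u v ⟨huv, hc⟩
        by_cases hu : u = 0 <;> by_cases hv : v = 0 <;> simp only [hu, hv, if_true, if_false] at hc ⊢
        · exact absurd rfl hc
        · rw [hu, sub_zero] at huv
          rw [if_pos huv]
          norm_num
        · rw [hv, zero_sub] at huv
          rw [if_neg fun h => hJ.neg_notMem u h huv]
          norm_num
        · exact absurd rfl hc
      · exact (Set.one_lt_ncard (Set.toFinite _)).2 ⟨0, ⟨0, by simp⟩, 1, ⟨x, by simp [hx]⟩, by norm_num⟩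
  · obtain ⟨_, ⟨x, rfl⟩, _, ⟨y, rfl⟩, _, ⟨z, rfl⟩, hxy, hxz, hyz⟩ :=
      (Set.two_lt_ncard (Set.toFinite _)).1 (not_le.1 h2)
    have hns : ¬ IsSimpleTournamentSet J := fun hs => hf.not_three_colours hJ hs hxy hyz hxz
    unfold IsSimpleTournamentSet at hns
    push Not at hns
    obtain ⟨H₀, hH₀, -, htop₀⟩ := hns
    obtain ⟨H, hH⟩ := (Set.toFinite {K : AddSubgroup G | IsModuleSubgroup J K ∧ K ≠ ⊤}).exists_maximal
      ⟨H₀, hH₀, htop₀⟩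
    obtain ⟨hHm, hHt⟩ := hH.prop
    have hq : IsSimpleTournamentSet (quotientSet J H) := by
      refine IsSimpleTournamentSet.quotient hHm fun K hK hlt => ?_
      by_contra hKt
      exact hlt.not_ge (hH.le_of_ge ⟨hK, hKt⟩ hlt.le)
    obtain ⟨w, hw⟩ : ∃ w, w ∉ H := by
      by_contra h
      push Not at h
      exact hHt (eq_top_iff.2 fun x _ => h x)
    obtain ⟨x, hx⟩ := exists_coset_ncard_range_le (f := f) (H := H)
      ((hJ.quotient hHm).exists_third ⟨w, fun h => hw ((QuotientAddGroup.eq_zero_iff w).1 h)⟩)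
      fun x y z hxy hyz hxz => hf.eq_of_distinct_cosets hJ hHm hq hxy hyz hxz
    have hlt : Nat.card H < n := by
      rw [← hn]
      exact lt_of_le_of_ne (Nat.card_le_card_of_injective _ H.subtype_injective)
        fun h => hHt (AddSubgroup.eq_top_of_card_eq H h)
    obtain ⟨g, hg, hcard⟩ := ih _ hlt rfl (hJ.restrict H) (hf.restrict H x)
    refine ⟨_, hg.extend hJ hHm, hx.trans ((Nat.add_le_add_right hcard 1).trans ?_)⟩
    -- The shift by one inside `H` frees colour 0 for the outside, compensating for the one missed
    -- colour.
    have h0 : (0 : ℕ) ∉ Nat.succ '' Set.range g := by simp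
    rw [← Set.ncard_image_of_injective _ Nat.succ_injective, ← Set.ncard_insert_of_notMem h0]
    refine Set.ncard_le_ncard (Set.insert_subset ⟨w, by simp [hw]⟩ ?_)
    rintro _ ⟨_, ⟨h, rfl⟩, rfl⟩
    exact ⟨h, by simp⟩

end Quotient

/-! ### From digraphs to colourings. -/

theorem IsTournamentSymbolSet.isTournamentSet {n : ℕ} {J : Finset (ZMod (2 * n + 1))}
    (hJ : IsTournamentSymbolSet n J) : IsTournamentSet (J : Set (ZMod (2 * n + 1))) := by
  have hneg : ∀ x ∈ J, -x ∉ J := by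
    intro x hx hx'
    -- The group has odd order, hence no involution.
    have hne : x ≠ -x := by
      intro e
      have hodd : Odd (Nat.card (ZMod (2 * n + 1))) := by
        rw [Nat.card_zmod]
        exact ⟨n, rfl⟩
      have h2 : 2 • x = 0 := by
        rw [two_nsmul]
        nth_rw 2 [e]
        exact add_neg_cancel x
      have hd : addOrderOf x ∣ 1 := by
        refine (Nat.dvd_gcd (addOrderOf_dvd_of_nsmul_eq_zero h2) (addOrderOf_dvd_natCard x)).trans
          hodd.coprime_two_left.gcd_eq_one.dvd
      rw [Nat.dvd_one, AddMonoid.addOrderOf_eq_one_iff] at hd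
      exact hJ.zero_notMem (hd ▸ hx)
    have := hJ.card_pair_inter x hx
    rw [Finset.inter_eq_left.2 (Finset.insert_subset hx (Finset.singleton_subset_iff.2 hx')),
      Finset.card_pair hne] at this
    omega
  refine ⟨hJ.zero_notMem, hneg, fun x hx => ?_⟩
  have hd : Disjoint J (J.image fun x => -x) := by
    rw [Finset.disjoint_left]
    intro a ha ha'
    obtain ⟨b, hb, rfl⟩ := Finset.mem_image.1 ha'
    exact hneg b hb ha
  have h0 : (0 : ZMod (2 * n + 1)) ∉ J ∪ J.image fun x => -x := by
    simp [hJ.zero_notMem]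
  have huniv : insert 0 (J ∪ J.image fun x => -x) = Finset.univ := by
    refine Finset.eq_univ_of_card _ ?_
    rw [Finset.card_insert_of_notMem h0, Finset.card_union_of_disjoint hd,
      Finset.card_image_of_injective _ neg_injective, hJ.card_eq, ZMod.card]
    omega
  have hx' : x ∈ insert 0 (J ∪ J.image fun x => -x) := huniv ▸ Finset.mem_univ x
  rcases Finset.mem_union.1 ((Finset.mem_insert.1 hx').resolve_left hx) with h | h
  · exact Or.inl h
  · obtain ⟨b, hb, rfl⟩ := Finset.mem_image.1 h
    exact Or.inr (by simpa using hb)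

/-- A colouring invariant under adjacency has at most as many colours as there are components. -/
theorem Digraph.ncard_range_le_numComponents {V : Type*} [Finite V] {ι : Type*} (D : Digraph V)
    (g : V → ι) (hg : ∀ u v, D.Adj u v → g u = g v) :
    (Set.range g).ncard ≤ D.numComponents := by
  have hg' : ∀ u v, D.toSimpleGraphInclusive.Reachable u v → g u = g v := by
    rintro u v ⟨p⟩
    induction p with
    | nil => rfl
    | cons h _ ih =>
      refine Eq.trans ?_ ih
      rw [Digraph.toSimpleGraphInclusive, SimpleGraph.fromRel_adj] at h
      rcases h.2 with h | h
      exacts [hg _ _ h, (hg _ _ h).symm]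
  let φ : D.toSimpleGraphInclusive.ConnectedComponent → Set.range g := fun C =>
    C.lift (fun v => ⟨g v, v, rfl⟩) fun u v p _ => Subtype.ext (hg' u v ⟨p⟩)
  refine Nat.card_le_card_of_surjective φ ?_
  rintro ⟨_, v, rfl⟩
  exact ⟨D.toSimpleGraphInclusive.connectedComponentMk v, rfl⟩

/-- A digraph whose arcs increase a height function is acyclic. -/
theorem Digraph.isDirectedAcyclic_of_height {V : Type*} {D : Digraph V} (h : V → ℤ)
    (hh : ∀ u v, D.Adj u v → h u < h v) : D.IsDirectedAcyclic := by
  rintro k hk ⟨c, -, hc⟩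
  have : NeZero k := ⟨by omega⟩
  obtain ⟨i, hi⟩ := Finite.exists_max fun i => h (c i)
  exact absurd (hi (i + 1)) (not_le.2 (hh _ _ (hc i)))

theorem Digraph.IsDirectedTriangleFree.not_triangle {V : Type*} {D : Digraph V}
    (hD : D.IsDirectedTriangleFree) {u v w : V} (huv : u ≠ v) (hvw : v ≠ w) (hwu : w ≠ u)
    (h₁ : D.Adj u v) (h₂ : D.Adj v w) (h₃ : D.Adj w u) : False := by
  -- `ZMod 3` unfolds to `Fin 3`, so the vector serves as the cyclic indexing.
  refine hD ⟨(![u, v, w] : Fin 3 → V), ?_, ?_⟩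
  · intro i j hij
    change Fin 3 at i j
    fin_cases i <;> fin_cases j <;> first | rfl | simp_all
  · intro i
    change Fin 3 at i
    fin_cases i
    exacts [h₁, h₂, h₃]

theorem mainTheorem4 (n : ℕ) (hn : 0 < n) (J : Finset (ZMod (2 * n + 1)))
    (hJ : IsTournamentSymbolSet n J) :
    (circulantTournament n J).acyclicDisconnection =
      (circulantTournament n J).triangleFreeDisconnection := by
  classical
  set T := circulantTournament n J with hT
  have hadj : ∀ u v, T.Adj u v ↔ v - u ∈ (J : Set (ZMod (2 * n + 1))) := fun u v => Iff.rfl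
  have hJ' := hJ.isTournamentSet
  apply le_antisymm
  · obtain ⟨H, hHT, hH, hk⟩ := T.isGreatest_acyclicDisconnection.1
    exact T.isGreatest_triangleFreeDisconnection.2 ⟨H, hHT, hH 3 (by norm_num), hk⟩
  · obtain ⟨H, hHT, hH, hk⟩ := T.isGreatest_triangleFreeDisconnection.1
    let C := (T \ H).toSimpleGraphInclusive.ConnectedComponent
    obtain ⟨e⟩ : Nonempty (C ↪ ℕ) := ⟨(Finite.equivFin C).toEmbedding.trans Fin.valEmbedding⟩
    -- Colouring by components of `T \ H` puts every bichromatic arc of `T` in `H`, so a rainbow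
    -- triangle would be a triangle of `H`.
    let f : ZMod (2 * n + 1) → ℕ := fun v =>
      e ((T \ H).toSimpleGraphInclusive.connectedComponentMk v)
    have hfH : ∀ u v, T.Adj u v → f u ≠ f v → H.Adj u v := by
      intro u v huv hc
      by_contra hH'
      refine hc (congrArg e (SimpleGraph.ConnectedComponent.sound (SimpleGraph.Adj.reachable ?_)))
      rw [Digraph.toSimpleGraphInclusive, SimpleGraph.fromRel_adj]
      exact ⟨fun h => hc (congrArg f h), Or.inl ⟨huv, hH'⟩⟩
    have hf : RainbowTriangleFree (J : Set (ZMod (2 * n + 1))) f := by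
      intro u v w h1 h2 h3
      by_contra hcon
      push Not at hcon
      obtain ⟨c1, c2, c3⟩ := hcon
      exact hH.not_triangle (fun h => c1 (congrArg f h)) (fun h => c2 (congrArg f h))
        (fun h => c3 (congrArg f h)) (hfH u v h1 c1) (hfH v w h2 c2) (hfH w u h3 c3)
    have hcardf : (Set.range f).ncard = (T \ H).numComponents := by
      have : Set.range f = Set.range e := by
        ext i
        constructor
        · rintro ⟨v, rfl⟩
          exact ⟨_, rfl⟩
        · rintro ⟨c, rfl⟩
          obtain ⟨v, rfl⟩ := c.exists_rep
          exact ⟨v, rfl⟩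
      rw [this, ← Nat.card_coe_set_eq, Nat.card_range_of_injective e.injective]
      rfl
    obtain ⟨g, ⟨h, hh⟩, hcard⟩ := RainbowTriangleFree.exists_acyclicColouring _ rfl hJ' hf
    -- Removing all bichromatic arcs of `g` leaves every component monochromatic, hence at least as
    -- many components as colours.
    let K : Digraph (ZMod (2 * n + 1)) := ⟨fun u v => T.Adj u v ∧ g u ≠ g v⟩
    have hK : (T \ K).numComponents ≤ T.acyclicDisconnection :=
      T.isGreatest_acyclicDisconnection.2 ⟨K, fun u v h => h.1,
        Digraph.isDirectedAcyclic_of_height h fun u v huv => hh u v huv, rfl⟩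
    have hgK : (Set.range g).ncard ≤ (T \ K).numComponents := by
      refine Digraph.ncard_range_le_numComponents _ g fun u v huv => ?_
      by_contra hc
      exact huv.2 ⟨huv.1, hc⟩
    rw [← hk, ← hcardf]
    exact hcard.trans (hgK.trans hK)
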